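/- Let $l,k\ge 0$ be integers and let $X=Gr(l,\mathbb C^{l+k})$ be the Grassmannian of $l$-dimensional subspaces of $\mathbb C^{l+k}$. Its cohomology ring $H^*(X,\mathbb Z)$ is described as the free abelian group on the Schubert classes $\sigma_\lambda$, indexed by the Young diagrams $\lambda$ contained in the $l\times k$ rectangle ($l$ rows, $k$ columns; written $\lambda\subseteq l\times k$), with the bilinear product $$\sigma_\lambda\cdot\sigma_\mu=\sum_{\nu\subseteq l\times k}c_{\lambda,\mu}^{\nu}\,\sigma_\nu .$$ Here $c_{\lambda,\mu}^{\nu}$ is the Littlewood–Richardson coefficient: the number of semistandard tableaux of skew shape $\nu/\lambda$ (none if $\lambda\not\subseteq\nu$) and content $\mu$ whose reverse reading word (rows from top to bottom, each read from right to left) is a lattice word. A product of three classes is read as $\sigma_\lambda\cdot\sigma_\mu\cdot\sigma_\nu=(\sigma_\lambda\cdot\sigma_\mu)\cdot\sigma_\nu$. Let $a,b,c$ and $A,B,C$ be integers with $0\le a,b,c\le l$ and $0\le A,B,C\le k$, and for $0\le m\le l$, $0\le M\le k$ let $m\times M$ denote the rectangular Young diagram with $m$ rows and $M$ columns (empty if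 $m=0$ or $M=0$). Then the following are equivalent: (I) there exist Young diagrams $\lambda,\mu,\nu\subseteq l\times k$ containing $a\times A$, $b\times B$ and $c\times C$, respectively, such that $\sigma_\lambda\cdot\sigma_\mu\cdot\sigma_\nu\ne 0$; (II) $\sigma_{a\times A}\cdot\sigma_{b\times B}\cdot\sigma_{c\times C}\ne 0$; (III) all of the following five conditions hold: - (i) $a+b\le l$ or $A+B\le k$; - (ii) $a+c\le l$ or $A+C\le k$; - (iii) $b+c\le l$ or $B+C\le k$; - (iv) $a+b+c\le l$ or $A+B+C\le 2k$; - (v) $a+b+c\le 2l$ or $A+B+C\le k$. -/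

import Mathlib

/-- The rectangular Young diagram `a × A`: `a` rows, each with `A` boxes. -/
def rectDiagram (a A : ℕ) : YoungDiagram where
  cells := Finset.range a ×ˢ Finset.range A
  isLowerSet := by
    rintro ⟨i, j⟩ ⟨i', j'⟩ ⟨hi, hj⟩ h
    simp only [Finset.coe_product, Set.mem_prod, Finset.mem_coe, Finset.mem_range] at h ⊢
    simp only at hi hj
    omega

theorem rectDiagram_mono {a A l k : ℕ} (ha : a ≤ l) (hA : A ≤ k) :
    rectDiagram a A ≤ rectDiagram l k :=
  YoungDiagram.cells_subset_iff.1
    (Finset.product_subset_product (Finset.range_mono ha) (Finset.range_mono hA))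

/-- The Young diagrams contained in the `l × k` rectangle; they index the Schubert classes of the
Grassmannian of `l`-dimensional subspaces of `ℂ ^ (l + k)`. -/
abbrev BoxDiagram (l k : ℕ) : Type :=
  {ν : YoungDiagram // ν ≤ rectDiagram l k}

instance (l k : ℕ) : Finite (BoxDiagram l k) :=
  Finite.of_injective
    (fun ν : BoxDiagram l k =>
      (⟨ν.1.cells, Finset.mem_powerset.2 (YoungDiagram.cells_subset_iff.2 ν.2)⟩ :
        {s : Finset (ℕ × ℕ) // s ∈ (rectDiagram l k).cells.powerset}))
    (fun _ _ h => Subtype.ext (YoungDiagram.ext (congrArg Subtype.val h)))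

noncomputable instance (l k : ℕ) : Fintype (BoxDiagram l k) :=
  Fintype.ofFinite _

/-- The rectangle `a × A` as a Young diagram contained in `l × k`. -/
def boxRect {l k : ℕ} (a A : ℕ) (ha : a ≤ l) (hA : A ≤ k) : BoxDiagram l k :=
  ⟨rectDiagram a A, rectDiagram_mono ha hA⟩

/-- The boxes of the skew shape `ν / lam`. -/
def skewCells (lam ν : YoungDiagram) : Finset (ℕ × ℕ) :=
  ν.cells \ lam.cells

/-- The Littlewood-Richardson tableaux of shape `ν / lam` and content `μ`: semistandard fillings
of `ν / lam` in which the number `m` occurs `μ_m` times and whose reverse reading word (each row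
read from right to left, the rows from top to bottom) is a lattice word. Rows, columns and entries
are numbered from `0`, and the entry is set to `0` off the skew shape. -/
@[ext]
structure LRTableau (lam μ ν : YoungDiagram) where
  entry : ℕ → ℕ → ℕ
  le : lam ≤ ν
  zeros : ∀ i j, (i, j) ∉ skewCells lam ν → entry i j = 0
  /-- Entries increase weakly along the rows. -/
  row_weak : ∀ i j₁ j₂, j₁ < j₂ → (i, j₁) ∈ skewCells lam ν → (i, j₂) ∈ skewCells lam ν →
    entry i j₁ ≤ entry i j₂
  /-- Entries increase strictly down the columns. -/
  col_strict : ∀ i₁ i₂ j, i₁ < i₂ → (i₁, j) ∈ skewCells lam ν → (i₂, j) ∈ skewCells lam ν →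
    entry i₁ j < entry i₂ j
  content : ∀ m, ((skewCells lam ν).filter fun d => entry d.1 d.2 = m).card = μ.rowLen m
  /-- In the part of the reading word that ends at the box `c`, there are at least as many
  entries `m` as entries `m + 1`. -/
  lattice : ∀ c ∈ skewCells lam ν, ∀ m,
    ((skewCells lam ν).filter fun d =>
      (d.1 < c.1 ∨ (d.1 = c.1 ∧ c.2 ≤ d.2)) ∧ entry d.1 d.2 = m + 1).card ≤
    ((skewCells lam ν).filter fun d =>
      (d.1 < c.1 ∨ (d.1 = c.1 ∧ c.2 ≤ d.2)) ∧ entry d.1 d.2 = m).card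

/-- There are finitely many Littlewood-Richardson tableaux, so that counting them with `Nat.card`
is meaningful. -/
instance (lam μ ν : YoungDiagram) : Finite (LRTableau lam μ ν) := by
  have hb : ∀ (T : LRTableau lam μ ν) (d : ℕ × ℕ), d ∈ skewCells lam ν →
      T.entry d.1 d.2 < μ.colLen 0 := by
    intro T d hd
    rw [← YoungDiagram.mem_iff_lt_colLen, YoungDiagram.mem_iff_lt_rowLen, ← T.content]
    exact Finset.card_pos.2 ⟨d, Finset.mem_filter.2 ⟨hd, rfl⟩⟩
  refine Finite.of_injective
    (fun (T : LRTableau lam μ ν) (d : {d // d ∈ skewCells lam ν}) =>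
      (⟨T.entry d.1.1 d.1.2, hb T d.1 d.2⟩ : Fin (μ.colLen 0))) ?_
  intro T T' h
  ext i j
  by_cases hd : (i, j) ∈ skewCells lam ν
  · exact congrArg Fin.val (congrFun h ⟨(i, j), hd⟩)
  · rw [T.zeros i j hd, T'.zeros i j hd]

/-- The Littlewood-Richardson coefficient `c_{lam, μ} ^ ν`. -/
noncomputable def lrCoeff (lam μ ν : YoungDiagram) : ℕ :=
  Nat.card (LRTableau lam μ ν)

/-- The integral cohomology `H^*(Gr(l, ℂ ^ (l + k)), ℤ)` in terms of its Schubert basis: the free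
abelian group on the Young diagrams contained in `l × k`. An element is given by its
coordinates. -/
def GrCohomology (l k : ℕ) : Type :=
  BoxDiagram l k → ℤ

namespace GrCohomology

noncomputable instance (l k : ℕ) : AddCommGroup (GrCohomology l k) :=
  inferInstanceAs (AddCommGroup (BoxDiagram l k → ℤ))

/-- The product of cohomology classes: the bilinear product whose structure constants in the
Schubert basis are the Littlewood-Richardson coefficients. -/
noncomputable instance (l k : ℕ) : Mul (GrCohomology l k) where
  mul x y := fun ν => ∑ lam : BoxDiagram l k, ∑ μ : BoxDiagram l k,
    x lam * y μ * (lrCoeff lam.1 μ.1 ν.1 : ℤ)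

theorem add_apply {l k : ℕ} (x y : GrCohomology l k) (ν : BoxDiagram l k) :
    (x + y) ν = x ν + y ν :=
  rfl

theorem mul_apply {l k : ℕ} (x y : GrCohomology l k) (ν : BoxDiagram l k) :
    (x * y) ν = ∑ lam : BoxDiagram l k, ∑ μ : BoxDiagram l k,
      x lam * y μ * (lrCoeff lam.1 μ.1 ν.1 : ℤ) :=
  rfl

noncomputable instance (l k : ℕ) : NonUnitalNonAssocRing (GrCohomology l k) :=
  { (inferInstance : AddCommGroup (GrCohomology l k)),
    (inferInstance : Mul (GrCohomology l k)) with
    left_distrib := fun x y z => funext fun ν => by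
      simp only [add_apply, mul_apply, mul_add, add_mul, Finset.sum_add_distrib]
    right_distrib := fun x y z => funext fun ν => by
      simp only [add_apply, mul_apply, add_mul, Finset.sum_add_distrib]
    zero_mul := fun x => funext fun ν => by
      rw [mul_apply]
      exact Finset.sum_eq_zero fun lam _ => Finset.sum_eq_zero fun μ _ => by
        rw [show (0 : GrCohomology l k) lam = 0 from rfl]; ring
    mul_zero := fun x => funext fun ν => by
      rw [mul_apply]
      exact Finset.sum_eq_zero fun lam _ => Finset.sum_eq_zero fun μ _ => by
        rw [show (0 : GrCohomology l k) μ = 0 from rfl]; ring }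

end GrCohomology

open Classical in
/-- The Schubert class `σ_lam`. -/
noncomputable def schubertClass {l k : ℕ} (lam : BoxDiagram l k) : GrCohomology l k :=
  fun ν => if ν = lam then 1 else 0

/-- `σ_lam · σ_μ = ∑ c_{lam, μ} ^ ν σ_ν`, the sum over the Young diagrams `ν` contained in
`l × k`. -/
theorem schubertClass_mul {l k : ℕ} (lam μ : BoxDiagram l k) :
    schubertClass lam * schubertClass μ =
      ∑ ν : BoxDiagram l k, lrCoeff lam.1 μ.1 ν.1 • schubertClass ν := by
  classical
  have key : ∀ (s : Finset (BoxDiagram l k)) (ρ : BoxDiagram l k),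
      (∑ ν ∈ s, lrCoeff lam.1 μ.1 ν.1 • schubertClass ν) ρ =
        ∑ ν ∈ s, (lrCoeff lam.1 μ.1 ν.1 : ℤ) * schubertClass ν ρ := by
    intro s ρ
    induction s using Finset.induction_on with
    | empty => rfl
    | insert a s ha ih =>
      rw [Finset.sum_insert ha, Finset.sum_insert ha, GrCohomology.add_apply, ih]
      congr 1
  refine funext fun ρ => ?_
  rw [GrCohomology.mul_apply, key]
  simp [schubertClass]

/-!
Littlewood-Richardson coefficients are nonnegative, so a triple product is nonzero exactly when there
are shapes `κ`, `ρ` in the `l × k` box with Littlewood-Richardson tableaux of types `(λ, μ, κ)` and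
`(κ, ν, ρ)` (`triple_mul_ne_zero_iff`).

Necessity of the five conditions. In a Littlewood-Richardson tableau the number of entries `x + 1`
in the rows up to `r` is at most the number of entries `x` above row `r`
(`LRTableau.countAbove_succ_le`), and equal entries lie in distinct columns. Hence,
if `λ ⊇ a × A` and `μ ⊇ b × B`, then the rows or columns of the two rectangles that exceed the
box overlap: `κ` contains `(a + b - l) × (A + B)` if `a + b > l` (`LRTableau.rect_le_of_rows`) and
`(a + b) × (A + B - k)` if `A + B > k` (`LRTableau.rect_le_of_cols`). The former gives the condition
on two rectangles (`LRTableau.fit`), applied to `λ, μ`, to `κ, ν` with `a × A ⊆ κ`, and to `κ, ν`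
with `b × B ⊆ κ`. If `a + b + c > l` and `A + B + C > 2 k`, then `A + B > k`, and the rectangles
`(a + b) × (A + B - k) ⊆ κ` and `c × C` violate it; if `a + b + c > 2 l` and `A + B + C > k`, so do
`(a + b - l) × (A + B) ⊆ κ` and `c × C`.

Sufficiency. A Littlewood-Richardson tableau amounts to interlacing row data
(`LRTableau.nonempty_of_rowData`). With it, one gets a nonzero product of `σ_κ` with `σ_{c × C}` as
soon as row `l - c` of `κ` has length at most `k - C` (`exists_lrTableau_rect`). It remains to find
such a `κ` in the product of `a × A` and `b × B` (`exists_fit_third`). If `a + b ≤ l`, put some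
columns of `b × B` below `a × A` and the others next to it; if `A + B ≤ k`, put some rows of `b × B`
to the right of `a × A` and the others below it; then sort. The conditions on the three rectangles say
that the number of these columns or rows can be chosen as required.
-/

/-! ### Littlewood-Richardson tableaux from row data -/

/-- A Littlewood-Richardson tableau from its row data: `g r x` is the column at which the entries
`≥ x` of row `r` begin, and `N r x` is the number of entries `x` above row `r`. -/
theorem LRTableau.nonempty_of_rowData {lam μ ν : YoungDiagram} (g N : ℕ → ℕ → ℕ) (L b : ℕ)
    (g_zero : ∀ r, g r 0 = lam.rowLen r) (g_top : ∀ r, g r b = ν.rowLen r)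
    (g_mono : ∀ r x, g r x ≤ g r (x + 1)) (g_interlace : ∀ r x, g (r + 1) (x + 1) ≤ g r x)
    (g_stop : ∀ r x, b ≤ x → g r (x + 1) = g r x)
    (N_zero : ∀ x, N 0 x = 0) (N_succ : ∀ r x, N (r + 1) x + g r x = N r x + g r (x + 1))
    (N_lattice : ∀ r x, N (r + 1) (x + 1) ≤ N r x)
    (hL : ν.rowLen L = 0) (N_content : ∀ x, N L x = μ.rowLen x) :
    Nonempty (LRTableau lam μ ν) := by
  classical
  have gm : ∀ r, Monotone (g r) := fun r => monotone_nat_of_le_succ (g_mono r)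
  have ga : ∀ x, Antitone fun r => g r x := fun x =>
    antitone_nat_of_succ_le fun r => (g_mono (r + 1) x).trans (g_interlace r x)
  have gtop : ∀ r x, g r x ≤ ν.rowLen r := by
    intro r x
    rw [← g_top]
    rcases le_total x b with h | h
    · exact gm r h
    · exact (Nat.le_induction le_rfl (fun y hy ih => (g_stop r y hy).le.trans ih) x h)
  have mem : ∀ r j, (r, j) ∈ skewCells lam ν ↔ g r 0 ≤ j ∧ j < g r b := by
    intro r j
    rw [skewCells, Finset.mem_sdiff, YoungDiagram.mem_cells, YoungDiagram.mem_cells,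
      YoungDiagram.mem_iff_lt_rowLen, YoungDiagram.mem_iff_lt_rowLen, g_zero, g_top]
    omega
  have ex : ∀ r j, ∃ x, ((r, j) ∈ skewCells lam ν → g r x ≤ j ∧ j < g r (x + 1)) ∧
      ((r, j) ∉ skewCells lam ν → x = 0) := by
    intro r j
    by_cases h : (r, j) ∈ skewCells lam ν
    · have h' := (mem r j).1 h
      have hex : ∃ x, j < g r (x + 1) := ⟨b, h'.2.trans_le (gm r b.le_succ)⟩
      refine ⟨Nat.find hex, fun _ => ⟨?_, Nat.find_spec hex⟩, fun h'' => absurd h h''⟩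
      rcases hx : Nat.find hex with _ | x
      · exact h'.1
      · exact not_lt.1 (Nat.find_min hex (m := x) (by omega))
    · exact ⟨0, fun h' => absurd h' h, fun _ => rfl⟩
  choose e he he0 using ex
  have uniq : ∀ r j x, (r, j) ∈ skewCells lam ν → (e r j = x ↔ g r x ≤ j ∧ j < g r (x + 1)) := by
    intro r j x h
    have h1 := he r j h
    refine ⟨fun hx => hx ▸ h1, fun h2 => ?_⟩
    rcases lt_trichotomy (e r j) x with h3 | h3 | h3
    · have := gm r (show e r j + 1 ≤ x from h3)
      omega
    · exact h3
    · have := gm r (show x + 1 ≤ e r j from h3)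
      omega
  have count : ∀ x r, ((skewCells lam ν).filter fun d => d.1 < r ∧ e d.1 d.2 = x).card = N r x := by
    intro x r
    induction r with
    | zero => simp [N_zero]
    | succ r ih =>
      have hrow : ((skewCells lam ν).filter fun d => d.1 = r ∧ e d.1 d.2 = x) =
          {r} ×ˢ Finset.Ico (g r x) (g r (x + 1)) := by
        ext ⟨i, j⟩
        simp only [Finset.mem_filter, Finset.mem_product, Finset.mem_singleton, Finset.mem_Ico]
        constructor
        · rintro ⟨h, rfl, h'⟩
          exact ⟨rfl, (uniq _ _ _ h).1 h'⟩
        · rintro ⟨rfl, h⟩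
          have hm : (i, j) ∈ skewCells lam ν :=
            (mem i j).2 ⟨(gm i x.zero_le).trans h.1, by rw [g_top]; exact h.2.trans_le (gtop _ _)⟩
          exact ⟨hm, rfl, (uniq _ _ _ hm).2 h⟩
      have hsplit : ((skewCells lam ν).filter fun d => d.1 < r + 1 ∧ e d.1 d.2 = x) =
          ((skewCells lam ν).filter fun d => d.1 < r ∧ e d.1 d.2 = x) ∪
          ((skewCells lam ν).filter fun d => d.1 = r ∧ e d.1 d.2 = x) := by
        rw [← Finset.filter_or]
        refine Finset.filter_congr fun d _ => ?_
        rw [Nat.lt_succ_iff_lt_or_eq]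
        tauto
      rw [hsplit, Finset.card_union_of_disjoint, ih, hrow, Finset.card_product,
        Finset.card_singleton, Nat.card_Ico]
      · have := N_succ r x
        have := g_mono r x
        omega
      · refine Finset.disjoint_filter.2 fun d _ h h' => ?_
        omega
  refine ⟨⟨e, ?_, ?_, ?_, ?_, ?_, ?_⟩⟩
  · rw [← YoungDiagram.cells_subset_iff]
    rintro ⟨r, j⟩ h
    rw [YoungDiagram.mem_cells, YoungDiagram.mem_iff_lt_rowLen] at h ⊢
    exact h.trans_le (g_zero r ▸ gtop r 0)
  · exact fun r j h => he0 r j h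
  · intro r j₁ j₂ hj h₁ h₂
    by_contra hlt
    have := gm r (show e r j₂ + 1 ≤ e r j₁ by omega)
    have := he r j₁ h₁
    have := he r j₂ h₂
    omega
  · intro r₁ r₂ j hr h₁ h₂
    by_contra hle
    have := gm r₁ (show e r₂ j ≤ e r₁ j by omega)
    have h3 : g r₂ (e r₂ j + 1) ≤ g (r₁ + 1) (e r₂ j + 1) := ga _ hr
    have := g_interlace r₁ (e r₂ j)
    have := he r₁ j h₁
    have := he r₂ j h₂
    omega
  · intro m
    rw [← N_content, ← count]
    refine congrArg _ (Finset.filter_congr fun d hd => ?_)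
    have h := (mem d.1 d.2).1 hd
    have h2 : d.1 < L := by
      by_contra hlt
      have h3 : g d.1 b ≤ g L b := ga b (not_lt.1 hlt)
      rw [g_top L, hL] at h3
      omega
    exact ⟨fun h => ⟨h2, h⟩, fun h => h.2⟩
  · intro c _ m
    refine le_trans ?_ ((count (m + 1) (c.1 + 1)).le.trans ((N_lattice c.1 m).trans
      ((count m c.1).ge.trans ?_))) <;>
    · refine Finset.card_le_card (Finset.monotone_filter_right _ fun d _ h => ?_)
      omega

/-- The Young diagram inside `l` rows whose row lengths are given by an antitone function. -/
def YoungDiagram.ofRowFun (l : ℕ) (f : ℕ → ℕ) (hf : Antitone f) : YoungDiagram where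
  cells := (Finset.range l ×ˢ Finset.range (f 0)).filter fun d => d.2 < f d.1
  isLowerSet := by
    rintro ⟨i, j⟩ ⟨i', j'⟩ ⟨hi, hj⟩ h
    simp only [Finset.coe_filter, Set.mem_ofPred_eq, Finset.mem_product, Finset.mem_range] at h ⊢
    have := hf hi
    simp only at hi hj this
    omega

theorem YoungDiagram.rowLen_eq_of_mem_iff {μ : YoungDiagram} {i n : ℕ}
    (h : ∀ j, (i, j) ∈ μ ↔ j < n) : μ.rowLen i = n := by
  have h1 := h (μ.rowLen i)
  have h2 := h n
  rw [YoungDiagram.mem_iff_lt_rowLen] at h1 h2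
  omega

theorem YoungDiagram.rowLen_ofRowFun {l : ℕ} {f : ℕ → ℕ} (hf : Antitone f)
    (hl : f l = 0) (i : ℕ) : (YoungDiagram.ofRowFun l f hf).rowLen i = f i := by
  refine YoungDiagram.rowLen_eq_of_mem_iff fun j => ?_
  rw [← YoungDiagram.mem_cells, YoungDiagram.ofRowFun, Finset.mem_filter, Finset.mem_product,
    Finset.mem_range, Finset.mem_range]
  have h0 : f i ≤ f 0 := hf i.zero_le
  refine ⟨fun h => h.2, fun h => ⟨⟨?_, h.trans_le h0⟩, h⟩⟩
  by_contra hi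
  have : f i ≤ f l := hf (not_lt.1 hi)
  omega

theorem rowLen_rectDiagram (a A i : ℕ) :
    (rectDiagram a A).rowLen i = if i < a then A else 0 := by
  refine YoungDiagram.rowLen_eq_of_mem_iff fun j => ?_
  rw [← YoungDiagram.mem_cells, rectDiagram, Finset.mem_product, Finset.mem_range,
    Finset.mem_range]
  split_ifs with h <;> simp [h]

theorem le_rectDiagram_iff {μ : YoungDiagram} {l k : ℕ} :
    μ ≤ rectDiagram l k ↔ μ.rowLen 0 ≤ k ∧ μ.rowLen l = 0 := by
  constructor
  · intro h
    constructor
    · by_contra hk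
      have := h (YoungDiagram.mem_iff_lt_rowLen.2 (not_le.1 hk))
      rw [YoungDiagram.mem_iff_lt_rowLen, rowLen_rectDiagram] at this
      split_ifs at this <;> omega
    · by_contra hl
      have := h (YoungDiagram.mem_iff_lt_rowLen.2 (Nat.pos_of_ne_zero hl))
      rw [YoungDiagram.mem_iff_lt_rowLen, rowLen_rectDiagram] at this
      simp at this
  · rintro ⟨h0, hl⟩ ⟨i, j⟩ h
    rw [YoungDiagram.mem_iff_lt_rowLen] at h ⊢
    rw [rowLen_rectDiagram]
    have h1 := μ.rowLen_anti 0 i i.zero_le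
    by_cases hi : i < l
    · rw [if_pos hi]; omega
    · have := μ.rowLen_anti l i (not_lt.1 hi)
      omega

theorem rectDiagram_le_iff {μ : YoungDiagram} {a A : ℕ} :
    rectDiagram a A ≤ μ ↔ ∀ i < a, A ≤ μ.rowLen i := by
  constructor
  · intro h i hi
    by_contra hA
    have h1 : (i, μ.rowLen i) ∈ rectDiagram a A := by
      rw [YoungDiagram.mem_iff_lt_rowLen, rowLen_rectDiagram, if_pos hi]
      exact not_le.1 hA
    exact lt_irrefl _ (YoungDiagram.mem_iff_lt_rowLen.1 (h h1))
  · rintro h ⟨i, j⟩ hm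
    rw [YoungDiagram.mem_iff_lt_rowLen] at hm ⊢
    rw [rowLen_rectDiagram] at hm
    split_ifs at hm with hi
    · exact hm.trans_le (h i hi)
    · omega

/-! ### Nonvanishing products with a rectangle -/

/-- Push the rectangle `c × C` to the right end of an `l × (C' + C)` box, drop its columns onto
those of `κ`, and slide the rows to the left. -/
theorem exists_lrTableau_rect {κ : YoungDiagram} {l c C C' : ℕ} (hc : c ≤ l)
    (hk : κ.rowLen 0 ≤ C' + C) (hl : κ.rowLen l = 0) (hfit : κ.rowLen (l - c) ≤ C') :
    ∃ ρ : YoungDiagram, Nonempty (LRTableau κ (rectDiagram c C) ρ) ∧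
      ∀ r, ρ.rowLen r = min (κ.rowLen r) C' +
        (if r < c then C' + C else max (κ.rowLen (r - c)) C') - C' := by
  -- `M r x` is the truncated length of row `r - x`, the rows above the box being full.
  obtain ⟨M, hM⟩ : ∃ M : ℕ → ℕ → ℕ,
      ∀ r x, M r x = if r < x then C' + C else max (κ.rowLen (r - x)) C' := ⟨_, fun _ _ => rfl⟩
  have anti : ∀ i j, i ≤ j → κ.rowLen j ≤ κ.rowLen i := fun i j h => κ.rowLen_anti i j h
  have M_le : ∀ r x, M r x ≤ C' + C := by
    intro r x
    have := anti 0 (r - x) (Nat.zero_le _)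
    rw [hM]; split_ifs <;> omega
  have le_M : ∀ r x, C' ≤ M r x := by
    intro r x
    rw [hM]; split_ifs <;> omega
  have M_zero : ∀ r, M r 0 = max (κ.rowLen r) C' := fun r => by simp [hM]
  have M_diag : ∀ r x, M (r + 1) (x + 1) = M r x := fun r x => by simp [hM]
  have M_mono : ∀ r x, M r x ≤ M r (x + 1) := by
    intro r x
    have h1 := anti 0 (r - x) (Nat.zero_le _)
    have h2 := anti (r - (x + 1)) (r - x) (by omega)
    rw [hM, hM]; split_ifs <;> omega
  have M_anti : ∀ r x, M (r + 1) x ≤ M r x := fun r x =>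
    (M_mono (r + 1) x).trans (M_diag r x).le
  have M_end : ∀ x, x ≤ c → M l x = C' := by
    intro x hx
    have := anti (l - c) (l - x) (by omega)
    rw [hM, if_neg (by omega)]; omega
  have M_first : ∀ x, M 0 (x + 1) = C' + C := fun x => by simp [hM]
  obtain ⟨g, hg⟩ : ∃ g : ℕ → ℕ → ℕ,
      ∀ r x, g r x = min (κ.rowLen r) C' + M r (min x c) - C' := ⟨_, fun _ _ => rfl⟩
  have g_le : ∀ r x, x ≤ c → g r x = min (κ.rowLen r) C' + M r x - C' := fun r x h => by
    rw [hg, min_eq_left h]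
  have g_ge : ∀ r x, c ≤ x → g r x = min (κ.rowLen r) C' + M r c - C' := fun r x h => by
    rw [hg, min_eq_right h]
  have g_anti : Antitone fun r => g r c := antitone_nat_of_succ_le fun r => by
    have := anti r (r + 1) r.le_succ
    have := M_anti r c
    simp only [g_le _ c le_rfl]
    omega
  have hgl : g l c = 0 := by
    rw [g_le _ c le_rfl, M_end c le_rfl, hl]; simp
  have hrow := YoungDiagram.rowLen_ofRowFun g_anti hgl
  refine ⟨YoungDiagram.ofRowFun l (fun r => g r c) g_anti, ?_, fun r => ?_⟩
  · refine LRTableau.nonempty_of_rowData g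
      (fun r x => if x < c then C' + C - M r (x + 1) else 0) l c ?_ (fun r => (hrow r).symm)
      ?_ ?_ (fun r x h => ?_) (fun x => ?_) ?_ ?_ ((hrow l).trans hgl) (fun x => ?_)
    · intro r
      rw [g_le _ _ c.zero_le, M_zero]
      omega
    · intro r x
      rcases lt_or_ge x c with h | h
      · rw [g_le _ _ h.le, g_le _ (x + 1) h]
        have := M_mono r x
        omega
      · rw [g_ge _ _ h, g_ge _ _ (by omega)]
    · intro r x
      have := anti r (r + 1) r.le_succ
      rcases lt_or_ge x c with h | h
      · rw [g_le _ _ h.le, g_le _ (x + 1) h, M_diag]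
        omega
      · rw [g_ge _ _ h, g_ge _ _ (by omega)]
        have := M_anti r c
        omega
    · rw [g_ge _ _ h, g_ge _ _ (by omega)]
    · simp only [M_first]
      simp
    · intro r x
      simp only [M_diag]
      split_ifs with h
      · rw [g_le _ _ h.le, g_le _ (x + 1) h]
        have := M_le r x
        have := M_le r (x + 1)
        have := le_M r x
        have := le_M r (x + 1)
        omega
      · rw [g_ge _ _ (not_lt.1 h), g_ge _ _ (by omega)]
    · intro r x
      simp only [M_diag]
      split_ifs <;> omega
    · rw [rowLen_rectDiagram]
      split_ifs with h
      · rw [M_end (x + 1) h]; omega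
      · rfl
  · rw [hrow, g_le _ c le_rfl, hM]

/-- Put the first `p` rows of `b × B` to the right of `a × A`, and stack the other `b - p` rows with the other
`a - p` rows of `a × A`, sorting by length. -/
theorem exists_lrTableau_rect_rect {a A b B p : ℕ} (hpa : p ≤ a) (hpb : p ≤ b) :
    ∃ κ : YoungDiagram, Nonempty (LRTableau (rectDiagram a A) (rectDiagram b B) κ) ∧
      ∀ r, κ.rowLen r = (if r < a then A else 0) +
        (if r < p then B else if r < b then B - A else 0) +
        (if a ≤ r ∧ r < a + b - p then min A B else 0) := by
  obtain ⟨F, hF⟩ : ∃ F : ℕ → ℕ → ℕ, ∀ r x, F r x =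
      if r < x then if r < p then B else if r < b then B - A else 0 else 0 := ⟨_, fun _ _ => rfl⟩
  obtain ⟨G, hG⟩ : ∃ G : ℕ → ℕ → ℕ, ∀ r x, G r x =
      if a ≤ r ∧ r < a + x - p ∧ r < a + b - p then min A B else 0 := ⟨_, fun _ _ => rfl⟩
  obtain ⟨g, hg⟩ : ∃ g : ℕ → ℕ → ℕ, ∀ r x, g r x = (if r < a then A else 0) + F r x + G r x :=
    ⟨_, fun _ _ => rfl⟩
  obtain ⟨N, hN⟩ : ∃ N : ℕ → ℕ → ℕ, ∀ r x, N r x =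
      (if x < r then if x < p then B else if x < b then B - A else 0 else 0) +
      (if p ≤ x ∧ x + a < r + p ∧ x < b then min A B else 0) := ⟨_, fun _ _ => rfl⟩
  have g_interlace : ∀ r x, g (r + 1) (x + 1) ≤ g r x := by
    intro r x
    rw [hg, hg, hF, hF, hG, hG]
    split_ifs <;> omega
  have g_mono : ∀ r x, g r x ≤ g r (x + 1) := by
    intro r x
    have h1 : F r x ≤ F r (x + 1) := by
      rw [hF, hF]; split_ifs <;> omega
    have h2 : G r x ≤ G r (x + 1) := by
      rw [hG, hG]; split_ifs <;> omega
    rw [hg, hg]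
    omega
  have g_anti : Antitone fun r => g r (a + b) :=
    antitone_nat_of_succ_le fun r => (g_mono _ _).trans (g_interlace _ _)
  have hgl : g (a + b) (a + b) = 0 := by
    rw [hg, hF, hG]
    split_ifs <;> omega
  have hrow := YoungDiagram.rowLen_ofRowFun g_anti hgl
  refine ⟨YoungDiagram.ofRowFun (a + b) (fun r => g r (a + b)) g_anti, ?_, fun r => ?_⟩
  · refine LRTableau.nonempty_of_rowData g N (a + b) (a + b) ?_ (fun r => (hrow r).symm)
      g_mono g_interlace (fun r x hx => ?_) (fun x => ?_) ?_ ?_ ((hrow _).trans hgl)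
      (fun x => ?_)
    · intro r
      rw [hg, hF, hG, rowLen_rectDiagram]
      split_ifs <;> omega
    · have h1 : F r (x + 1) = F r x := by
        rw [hF, hF]; split_ifs <;> omega
      have h2 : G r (x + 1) = G r x := by
        rw [hG, hG]; split_ifs <;> omega
      rw [hg, hg, h1, h2]
    · rw [hN]
      split_ifs <;> omega
    · intro r x
      -- Row `r` has the entries `x = r`, counted by `F`, and `x = r + p - a`, counted by `G`.
      have h1 : F r (x + 1) = F r x +
          if r = x then if x < p then B else if x < b then B - A else 0 else 0 := by
        rw [hF, hF]; split_ifs <;> omega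
      have h2 : G r (x + 1) = G r x +
          if p ≤ x ∧ x + a = r + p ∧ x < b then min A B else 0 := by
        rw [hG, hG]; split_ifs <;> omega
      have h3 : N (r + 1) x = N r x +
          (if r = x then if x < p then B else if x < b then B - A else 0 else 0) +
          if p ≤ x ∧ x + a = r + p ∧ x < b then min A B else 0 := by
        rw [hN, hN]; split_ifs <;> omega
      rw [hg, hg, h1, h2, h3]
      omega
    · intro r x
      rw [hN, hN]
      split_ifs <;> omega
    · rw [hN, rowLen_rectDiagram]
      split_ifs <;> omega
  · rw [hrow, hg, hF, hG]
    split_ifs <;> omega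

/-! ### Rectangles forced by a Littlewood-Richardson tableau -/

namespace LRTableau

/-- The number of entries `x` above row `r`. -/
def countAbove {lam μ ν : YoungDiagram} (T : LRTableau lam μ ν) (r x : ℕ) : ℕ :=
  ((skewCells lam ν).filter fun d => d.1 < r ∧ T.entry d.1 d.2 = x).card

theorem countAbove_mono {lam μ ν : YoungDiagram} (T : LRTableau lam μ ν) {r s : ℕ} (h : r ≤ s)
    (x : ℕ) : T.countAbove r x ≤ T.countAbove s x :=
  Finset.card_le_card (Finset.monotone_filter_right _ fun _ _ hd => ⟨hd.1.trans_le h, hd.2⟩)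

/-- The lattice condition, read at the leftmost entry `x + 1` of row `r`: the entries `x` of row `r`
come later in the reading word. -/
theorem countAbove_succ_le {lam μ ν : YoungDiagram} (T : LRTableau lam μ ν) (r x : ℕ) :
    T.countAbove (r + 1) (x + 1) ≤ T.countAbove r x := by
  classical
  by_cases h : ∃ j, (r, j) ∈ skewCells lam ν ∧ T.entry r j = x + 1
  · obtain ⟨hj, hx⟩ := Nat.find_spec h
    refine le_trans (Finset.card_le_card (Finset.monotone_filter_right _ fun d hd hd' => ?_))
      ((T.lattice _ hj x).trans
        (Finset.card_le_card (Finset.monotone_filter_right _ fun d hd hd' => ?_)))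
    · refine ⟨?_, hd'.2⟩
      rcases Nat.lt_succ_iff_lt_or_eq.1 hd'.1 with h1 | h1
      · exact Or.inl h1
      · subst h1
        exact Or.inr ⟨rfl, Nat.find_min' h ⟨hd, hd'.2⟩⟩
    · refine ⟨?_, hd'.2⟩
      rcases hd'.1 with h1 | ⟨h1, h2⟩
      · exact h1
      · obtain ⟨i, j⟩ := d
        simp only at h1 h2 hd'
        subst h1
        exfalso
        rcases h2.lt_or_eq with h3 | h3
        · have := T.row_weak _ _ _ h3 hj hd
          omega
        · rw [h3] at hx
          omega
  · have h1 : T.countAbove (r + 1) (x + 1) ≤ T.countAbove r (x + 1) := by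
      refine Finset.card_le_card (Finset.monotone_filter_right _ fun d hd hd' => ⟨?_, hd'.2⟩)
      rcases Nat.lt_succ_iff_lt_or_eq.1 hd'.1 with h1 | h1
      · exact h1
      · subst h1
        exact absurd ⟨_, hd, hd'.2⟩ h
    refine h1.trans ?_
    cases r with
    | zero => simp [countAbove]
    | succ r => exact (countAbove_succ_le T r x).trans (T.countAbove_mono r.le_succ x)

theorem countAbove_add_le {lam μ ν : YoungDiagram} (T : LRTableau lam μ ν) (r x n : ℕ) :
    T.countAbove (r + n) (x + n) ≤ T.countAbove r x := by
  induction n with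
  | zero => exact le_rfl
  | succ n ih => exact (T.countAbove_succ_le (r + n) (x + n)).trans ih

/-- Equal entries lie in distinct columns. -/
theorem card_le_of_cols {lam μ ν : YoungDiagram} (T : LRTableau lam μ ν) {x m n : ℕ}
    {s : Finset (ℕ × ℕ)} (hs : s ⊆ skewCells lam ν) (hx : ∀ d ∈ s, T.entry d.1 d.2 = x)
    (hcol : ∀ d ∈ s, m ≤ d.2 ∧ d.2 < n) : s.card ≤ n - m := by
  rw [← Nat.card_Ico]
  refine Finset.card_le_card_of_injOn Prod.snd (fun d hd => ?_) ?_
  · simpa using hcol d hd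
  · rintro ⟨i, j⟩ hd ⟨i', j'⟩ hd' (rfl : j = j')
    have h1 := hx _ hd
    have h2 := hx _ hd'
    rcases lt_trichotomy i i' with h | h | h
    · have := T.col_strict _ _ _ h (hs hd) (hs hd')
      simp only at h1 h2
      omega
    · rw [h]
    · have := T.col_strict _ _ _ h (hs hd') (hs hd)
      simp only at h1 h2
      omega

/-- Equal entries in the rows from `r` to `s - 1` and in the columns from `m` on make row `r` of `ν`
long. -/
theorem lt_rowLen_of_lt_countAbove_sub {lam μ ν : YoungDiagram} (T : LRTableau lam μ ν) {x r s m n : ℕ}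
    (hcol : ∀ d ∈ skewCells lam ν, r ≤ d.1 → d.1 < s → m ≤ d.2)
    (hn : n < T.countAbove s x - T.countAbove r x) : m + n < ν.rowLen r := by
  classical
  by_contra hlt
  have hsub : ((skewCells lam ν).filter fun d => r ≤ d.1 ∧ d.1 < s ∧ T.entry d.1 d.2 = x).card ≤
      m + n - m := by
    refine T.card_le_of_cols (Finset.filter_subset _ _) (x := x) (fun d hd => ?_) fun d hd => ?_
    · exact (Finset.mem_filter.1 hd).2.2.2
    · obtain ⟨hd, h1, h2, -⟩ := Finset.mem_filter.1 hd
      refine ⟨hcol d hd h1 h2, ?_⟩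
      have h3 : (d.1, d.2) ∈ ν := (Finset.mem_sdiff.1 hd).1
      rw [YoungDiagram.mem_iff_lt_rowLen] at h3
      have := ν.rowLen_anti _ _ h1
      omega
  have hle : T.countAbove s x ≤ T.countAbove r x +
      ((skewCells lam ν).filter fun d => r ≤ d.1 ∧ d.1 < s ∧ T.entry d.1 d.2 = x).card := by
    refine (Finset.card_le_card fun d hd => ?_).trans (Finset.card_union_le _ _)
    rw [← Finset.filter_or]
    obtain ⟨hd, h1⟩ := Finset.mem_filter.1 hd
    refine Finset.mem_filter.2 ⟨hd, ?_⟩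
    rcases lt_or_ge d.1 r with h | h
    · exact Or.inl ⟨h, h1.2⟩
    · exact Or.inr ⟨h, h1⟩
  omega

theorem countAbove_eq_rowLen {lam μ ν : YoungDiagram} (T : LRTableau lam μ ν) {l : ℕ}
    (hl : ν.rowLen l = 0) (x : ℕ) : T.countAbove l x = μ.rowLen x := by
  rw [← T.content, countAbove]
  refine congrArg _ (Finset.filter_congr fun d hd => ⟨fun h => h.2, fun h => ⟨?_, h⟩⟩)
  by_contra hlt
  have h3 : (d.1, d.2) ∈ ν := (Finset.mem_sdiff.1 hd).1
  rw [YoungDiagram.mem_iff_lt_rowLen] at h3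
  have := ν.rowLen_anti _ _ (not_lt.1 hlt)
  omega

theorem le_col_of_rect_le {lam ν : YoungDiagram} {a A : ℕ} (hlam : rectDiagram a A ≤ lam)
    {d : ℕ × ℕ} (hd : d ∈ skewCells lam ν) (h : d.1 < a) : A ≤ d.2 := by
  by_contra hlt
  refine (Finset.mem_sdiff.1 hd).2 (hlam ?_)
  rw [← Prod.mk.eta (p := d), YoungDiagram.mem_iff_lt_rowLen,
    rowLen_rectDiagram, if_pos h]
  omega

/-- In a shape with at most `l` rows, the rows of two rectangles overlap: the entries `a + b - l - 1`
that lie in the first `a` rows are to the right of `a × A`. -/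
theorem rect_le_of_rows {lam μ ν : YoungDiagram} (T : LRTableau lam μ ν) {l a A b B : ℕ}
    (hl : ν.rowLen l = 0) (hlam : rectDiagram a A ≤ lam) (hμ : rectDiagram b B ≤ μ) (ha : a ≤ l)
    (hb : b ≤ l) (hab : l < a + b) : rectDiagram (a + b - l) (A + B) ≤ ν := by
  obtain ⟨x, hx⟩ : ∃ x, a + b - l = x + 1 := ⟨a + b - l - 1, by omega⟩
  rw [rectDiagram_le_iff] at hμ ⊢
  suffices h : A + B ≤ ν.rowLen x by
    intro i hi
    exact h.trans (ν.rowLen_anti i x (by omega))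
  rcases Nat.eq_zero_or_pos B with rfl | hB
  · exact rectDiagram_le_iff.1 (hlam.trans T.le) x (by omega)
  · have h1 := T.countAbove_add_le a x (l - a)
    rw [show a + (l - a) = l by omega, T.countAbove_eq_rowLen hl] at h1
    have h2 := hμ (x + (l - a)) (by omega)
    have h3 := T.countAbove_add_le 0 0 x
    have h4 : T.countAbove 0 0 = 0 := by simp [countAbove]
    rw [zero_add, h4] at h3
    have h5 := T.lt_rowLen_of_lt_countAbove_sub (r := x) (s := a) (m := A) (n := B - 1) (x := x)
      (fun d hd _ h => le_col_of_rect_le hlam hd h) (by omega)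
    omega

/-- In a shape with at most `k` columns, the columns of two rectangles overlap: at most `k - A`
entries `0` fit above row `a`, hence at most `k - A` entries `b - 1` above row `a + b - 1`. -/
theorem rect_le_of_cols {lam μ ν : YoungDiagram} (T : LRTableau lam μ ν) {l k a A b B : ℕ}
    (hl : ν.rowLen l = 0) (hk : ν.rowLen 0 ≤ k) (hlam : rectDiagram a A ≤ lam)
    (hμ : rectDiagram b B ≤ μ) (hA : A ≤ k) (hB : B ≤ k) (hAB : k < A + B) :
    rectDiagram (a + b) (A + B - k) ≤ ν := by
  rcases b with _ | x
  · rw [rectDiagram_le_iff]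
    intro i hi
    have := rectDiagram_le_iff.1 (hlam.trans T.le) i hi
    omega
  · rw [rectDiagram_le_iff] at hμ ⊢
    have h1 := T.countAbove_add_le a 0 x
    have h2 : T.countAbove a 0 ≤ k - A := by
      refine T.card_le_of_cols (Finset.filter_subset _ _) (x := 0) (fun d hd => ?_) fun d hd => ?_
      · exact (Finset.mem_filter.1 hd).2.2
      · obtain ⟨hd, h, -⟩ := Finset.mem_filter.1 hd
        refine ⟨le_col_of_rect_le hlam hd h, ?_⟩
        have h3 : (d.1, d.2) ∈ ν := (Finset.mem_sdiff.1 hd).1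
        rw [YoungDiagram.mem_iff_lt_rowLen] at h3
        have := ν.rowLen_anti 0 d.1 d.1.zero_le
        omega
    have h3 := hμ x (by omega)
    rw [← T.countAbove_eq_rowLen hl] at h3
    rw [zero_add] at h1
    have h4 := T.lt_rowLen_of_lt_countAbove_sub (r := a + x) (s := l) (m := 0) (n := A + B - k - 1)
      (x := x) (fun d _ _ _ => d.2.zero_le) (by omega)
    intro i hi
    have := ν.rowLen_anti i (a + x) (by omega)
    omega

end LRTableau

/-- Two rectangles with a nonzero product fit into opposite corners of the `l × k` box. -/
theorem LRTableau.fit {lam μ ν : YoungDiagram} (T : LRTableau lam μ ν) {l k a A b B : ℕ}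
    (hν : ν ≤ rectDiagram l k) (hlam : rectDiagram a A ≤ lam) (hμ : rectDiagram b B ≤ μ)
    (ha : a ≤ l) (hb : b ≤ l) : a + b ≤ l ∨ A + B ≤ k := by
  by_contra! h
  rw [le_rectDiagram_iff] at hν
  have := rectDiagram_le_iff.1 (T.rect_le_of_rows hν.2 hlam hμ ha hb h.1) 0 (by omega)
  omega

/-! ### Triple products -/

theorem schubertClass_mul_apply {l k : ℕ} (lam μ κ : BoxDiagram l k) :
    (schubertClass lam * schubertClass μ) κ = (lrCoeff lam.1 μ.1 κ.1 : ℤ) := by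
  classical
  rw [GrCohomology.mul_apply]
  simp [schubertClass]

theorem triple_mul_apply {l k : ℕ} (lam μ ν ρ : BoxDiagram l k) :
    (schubertClass lam * schubertClass μ * schubertClass ν) ρ =
      ∑ κ : BoxDiagram l k, (lrCoeff lam.1 μ.1 κ.1 : ℤ) * (lrCoeff κ.1 ν.1 ρ.1 : ℤ) := by
  classical
  rw [GrCohomology.mul_apply]
  simp_rw [schubertClass_mul_apply]
  simp [schubertClass]

theorem lrCoeff_ne_zero_iff {lam μ ν : YoungDiagram} :
    lrCoeff lam μ ν ≠ 0 ↔ Nonempty (LRTableau lam μ ν) := by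
  rw [lrCoeff, ← Nat.pos_iff_ne_zero, Finite.card_pos_iff]

/-- Littlewood-Richardson coefficients are nonnegative, so nothing cancels in a triple product. -/
theorem triple_mul_ne_zero_iff {l k : ℕ} (lam μ ν : BoxDiagram l k) :
    schubertClass lam * schubertClass μ * schubertClass ν ≠ 0 ↔
      ∃ κ ρ : BoxDiagram l k,
        Nonempty (LRTableau lam.1 μ.1 κ.1) ∧ Nonempty (LRTableau κ.1 ν.1 ρ.1) := by
  simp_rw [← lrCoeff_ne_zero_iff]
  constructor
  · intro h
    by_contra! hno
    refine h (funext fun ρ => ?_)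
    rw [triple_mul_apply]
    refine Finset.sum_eq_zero fun κ _ => ?_
    by_cases h1 : lrCoeff lam.1 μ.1 κ.1 = 0
    · simp [h1]
    · simp [hno κ ρ h1]
  · rintro ⟨κ, ρ, h1, h2⟩ h
    have h3 := congrFun h ρ
    rw [triple_mul_apply] at h3
    have h4 := (Finset.sum_eq_zero_iff_of_nonneg fun κ _ => by positivity).1 h3 κ
      (Finset.mem_univ _)
    exact mul_ne_zero (Int.natCast_ne_zero.2 h1) (Int.natCast_ne_zero.2 h2) h4

/-- The product of two rectangles contains a shape that leaves room for the third. -/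
theorem exists_fit_third {l k a A b B c C : ℕ}
    (ha : a ≤ l) (hA : A ≤ k) (hb : b ≤ l) (hB : B ≤ k) (hc : c ≤ l)
    (h1 : a + b ≤ l ∨ A + B ≤ k) (h2 : a + c ≤ l ∨ A + C ≤ k) (h3 : b + c ≤ l ∨ B + C ≤ k)
    (h4 : a + b + c ≤ l ∨ A + B + C ≤ 2 * k) (h5 : a + b + c ≤ 2 * l ∨ A + B + C ≤ k)
    (hC : C ≤ k) :
    ∃ κ : YoungDiagram, Nonempty (LRTableau (rectDiagram a A) (rectDiagram b B) κ) ∧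
      κ.rowLen 0 ≤ k ∧ κ.rowLen l = 0 ∧ κ.rowLen (l - c) ≤ k - C := by
  rcases h1 with h1 | h1
  · -- Stack `P` columns, as many as the room left by `c × C` permits.
    obtain ⟨P, hP⟩ : ∃ P, P = if a + b + c ≤ l then min A B else min (min A B) (k - C) := ⟨_, rfl⟩
    have hPA : P ≤ A := by split_ifs at hP <;> omega
    have hPB : P ≤ B := by split_ifs at hP <;> omega
    obtain ⟨κ, hT, hκ⟩ := exists_lrTableau_rect (κ := rectDiagram a A) (l := a + b) (c := b)
      (C := B) (C' := A - P) (by omega) (by rw [rowLen_rectDiagram]; split_ifs <;> omega)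
      (by rw [rowLen_rectDiagram]; split_ifs <;> omega)
      (by rw [rowLen_rectDiagram]; split_ifs <;> omega)
    simp only [rowLen_rectDiagram] at hκ
    refine ⟨κ, hT, ?_, ?_, ?_⟩
    · rw [hκ]
      split_ifs at hP ⊢ <;> omega
    · rw [hκ]
      split_ifs at hP ⊢ <;> omega
    · rw [hκ]
      split_ifs at hP ⊢ <;> omega
  · -- Put `p` rows side by side, as many as the room left by `c × C` permits.
    obtain ⟨p, hp⟩ : ∃ p, p = if A + B + C ≤ k then min a b else min (min a b) (l - c) := ⟨_, rfl⟩
    have hpa : p ≤ a := by split_ifs at hp <;> omega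
    have hpb : p ≤ b := by split_ifs at hp <;> omega
    obtain ⟨κ, hT, hκ⟩ := exists_lrTableau_rect_rect (A := A) (B := B) hpa hpb
    refine ⟨κ, hT, ?_, ?_, ?_⟩
    · rw [hκ]
      split_ifs at hp ⊢ <;> omega
    · rw [hκ]
      split_ifs at hp ⊢ <;> omega
    · rw [hκ]
      split_ifs at hp ⊢ <;> omega

theorem theorem1p3 (l k a A b B c C : ℕ)
    (ha : a ≤ l) (hA : A ≤ k) (hb : b ≤ l) (hB : B ≤ k) (hc : c ≤ l) (hC : C ≤ k) :
    List.TFAE [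
      ∃ lam μ ν : BoxDiagram l k,
        boxRect a A ha hA ≤ lam ∧ boxRect b B hb hB ≤ μ ∧ boxRect c C hc hC ≤ ν ∧
          schubertClass lam * schubertClass μ * schubertClass ν ≠ 0,
      schubertClass (boxRect a A ha hA) * schubertClass (boxRect b B hb hB) *
        schubertClass (boxRect c C hc hC) ≠ 0,
      (a + b ≤ l ∨ A + B ≤ k) ∧
        (a + c ≤ l ∨ A + C ≤ k) ∧
        (b + c ≤ l ∨ B + C ≤ k) ∧
        (a + b + c ≤ l ∨ A + B + C ≤ 2 * k) ∧
        (a + b + c ≤ 2 * l ∨ A + B + C ≤ k)] := by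
  tfae_have 2 → 1 := fun h => ⟨_, _, _, le_rfl, le_rfl, le_rfl, h⟩
  tfae_have 1 → 3 := by
    rintro ⟨lam, μ, ν, hlam, hμ, hν, h⟩
    obtain ⟨κ, ρ, ⟨T⟩, ⟨S⟩⟩ := (triple_mul_ne_zero_iff _ _ _).1 h
    change rectDiagram a A ≤ lam.1 at hlam
    change rectDiagram b B ≤ μ.1 at hμ
    change rectDiagram c C ≤ ν.1 at hν
    have hκ := le_rectDiagram_iff.1 κ.2
    have h1 := T.fit κ.2 hlam hμ ha hb
    have h2 := S.fit ρ.2 (hlam.trans T.le) hν ha hc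
    have h3 : b + c ≤ l ∨ B + C ≤ k := by
      rcases Nat.eq_zero_or_pos B with rfl | hB0
      · exact Or.inr (by omega)
      · -- The empty rectangle `0 × k` forces `κ` to contain `b × B`.
        have h0 : rectDiagram 0 k ≤ lam.1 := rectDiagram_le_iff.2 fun i hi => absurd hi (by omega)
        have h := T.rect_le_of_cols hκ.2 hκ.1 h0 hμ le_rfl hB (by omega)
        rw [zero_add, Nat.add_sub_cancel_left] at h
        exact S.fit ρ.2 h hν hb hc
    refine ⟨h1, h2, h3, ?_, ?_⟩
    · by_contra! hcon
      have h := T.rect_le_of_cols hκ.2 hκ.1 hlam hμ hA hB (by omega)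
      have := S.fit ρ.2 h hν (by omega) hc
      omega
    · by_contra! hcon
      have h := T.rect_le_of_rows hκ.2 hlam hμ ha hb (by omega)
      have := S.fit ρ.2 h hν (by omega) hc
      omega
  tfae_have 3 → 2 := by
    rintro ⟨h1, h2, h3, h4, h5⟩
    obtain ⟨κ, hT, hk, hl, hfit⟩ := exists_fit_third ha hA hb hB hc h1 h2 h3 h4 h5 hC
    obtain ⟨ρ, hS, hρ⟩ := exists_lrTableau_rect (κ := κ) (C := C) hc (by omega) hl hfit
    refine (triple_mul_ne_zero_iff _ _ _).2 ⟨⟨κ, le_rectDiagram_iff.2 ⟨hk, hl⟩⟩,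
      ⟨ρ, le_rectDiagram_iff.2 ⟨?_, ?_⟩⟩, hT, hS⟩
    · rw [hρ, Nat.zero_sub]
      split_ifs <;> omega
    · rw [hρ, if_neg (by omega)]
      omega
  tfae_finish
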